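/- Let $\sigma=\mathrm{Prop}\cup\{R_i\mid i\in I\}$ be a signature with a finite set $\mathrm{Prop}$ of unary proposition letters and binary actions $R_i$ indexed by a finite set $I$. A $\sigma$-LTS $M_a$ is a (possibly infinite) $\sigma$-structure $M$ with a distinguished state $a$. It is image-finite if every state $m$ has only finitely many successors, i.e. states $n$ with $R_i^M(m,n)$ for some $i\in I$; it is point-generated if every state is reachable from $a$ by a directed path (possibly of length $0$) of transitions. Homomorphisms and isomorphisms of $\sigma$-LTSs preserve distinguished states. Let $\mathcal{PG}_\sigma$ be the class of finite point-generated $\sigma$-LTSs, and let $\mathrm{hom}_{\mathbb N}(T_c,M_a)$ be the number of homomorphisms from $T_c$ to $M_a$. Let $\mathtt{gsub}(M_a)$ be the smallest substructure of $M$ that contains $a$ and is closed under successors, with distinguished state $a$. Nominal-free hybrid logic $\mathrm{HL}(\downarrow,@)$ has the formulas $$\varphi ::= p\mid x\mid \varphi\land\varphi\mid\varphi\lor\varphi\mid\lnot\varphi\mid\Diamond_i\varphi\mid\square_i\varphi\mid\;\downarrow x.\varphi\mid @_x\varphi,$$ with $p\in\mathrm{Prop}$, $i\in I$, and $x$ from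 a countably infinite set of world variables. Under an assignment $g$ of states to world variables, the propositional, Boolean and modal clauses are as usual, and $M_m,g\models x$ iff $g(x)=m$; $M_m,g\models\;\downarrow x.\varphi$ iff $M_m,g[x\mapsto m]\models\varphi$; $M_m,g\models @_x\varphi$ iff $M_{g(x)},g\models\varphi$. A sentence is a formula without free world variables, where $\downarrow x$ binds $x$; its truth in $M_a$ does not depend on $g$. Let $M_a$ and $N_b$ be image-finite $\sigma$-LTSs. Then for every $T_c\in\mathcal{PG}_\sigma$ there are only finitely many homomorphisms from $T_c$ to $M_a$ and from $T_c$ to $N_b$, and the following are equivalent: 1. $\mathrm{hom}_{\mathbb N}(T_c,M_a)=\mathrm{hom}_{\mathbb N}(T_c,N_b)$ for all $T_c\in\mathcal{PG}_\sigma$; 2. $\mathtt{gsub}(M_a)\cong\mathtt{gsub}(N_b)$; 3. $M_a$ and $N_b$ satisfy the same sentences of $\mathrm{HL}(\downarrow,@)$. -/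

import Mathlib

/-!
Both homomorphism counts and hybrid sentences only see the submodel generated by the distinguished
state, so `M` and `N` may be assumed to be point-generated. The states within distance `d` of the
distinguished state then form a finite point-generated LTS, the ball of radius `d`.

Equal counts force every ball of `M` to map injectively to `N`: sorting the homomorphisms `T → M` by
their kernels gives `hom(T, M) = ∑ inj(T/∼, M)`, over all equivalence relations `∼` on `T`, so by
induction on the size of `T` the numbers of injective homomorphisms to `M` and to `N` agree as well.
The same sentences force it too: as in the Hennessy–Milner theorem, names for the states of a ball
of `M` can be matched one after the other with names for states of `N`.

If every ball of `M` maps injectively to `N` and conversely, then compactness provides injective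
homomorphisms `F : M → N` and `G : N → M`. The map `G ∘ F` permutes each ball, which is finite, so
all states are periodic under it, and this makes `F` an isomorphism.
-/

universe uP uI u v w

/-- A labeled transition system over the modal signature with proposition letters `P` and
actions indexed by `I`: a structure with a distinguished state `pt`. -/
structure LTS (P : Type uP) (I : Type uI) where
  State : Type u
  val : P → State → Prop
  rel : I → State → State → Prop
  pt : State

namespace LTS

variable {P : Type uP} {I : Type uI}

/-- `m` has a transition to `n` along some action. -/
def Step (M : LTS.{uP, uI, u} P I) (m n : M.State) : Prop := ∃ i, M.rel i m n

/-- The set of successors of a state, along all actions. -/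
def succ (M : LTS.{uP, uI, u} P I) (m : M.State) : Set M.State := {n | M.Step m n}

def ImageFinite (M : LTS.{uP, uI, u} P I) : Prop := ∀ m, (M.succ m).Finite

/-- Every state is reached from the distinguished one by a directed path, possibly of length 0. -/
def PointGenerated (M : LTS.{uP, uI, u} P I) : Prop :=
  ∀ m, Relation.ReflTransGen M.Step M.pt m

/-- The class of finite point-generated LTSs. -/
def PG (P : Type uP) (I : Type uI) : Set (LTS.{uP, uI, w} P I) :=
  {T | Finite T.State ∧ T.PointGenerated}

/-- Homomorphisms of LTSs; they preserve the distinguished state. -/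
structure Hom (M : LTS.{uP, uI, u} P I) (N : LTS.{uP, uI, v} P I) where
  toFun : M.State → N.State
  map_pt : toFun M.pt = N.pt
  map_val : ∀ p m, M.val p m → N.val p (toFun m)
  map_rel : ∀ i m n, M.rel i m n → N.rel i (toFun m) (toFun n)

/-- Existence of an isomorphism: a homomorphism with a homomorphism as two-sided inverse. -/
def Isomorphic (M : LTS.{uP, uI, u} P I) (N : LTS.{uP, uI, v} P I) : Prop :=
  ∃ (f : Hom M N) (g : Hom N M),
    Function.LeftInverse g.toFun f.toFun ∧ Function.RightInverse g.toFun f.toFun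

/-- The homomorphism count over a semiring `S`: the unit of `S` added to itself as many times as
there are homomorphisms. Meaningful when there are only finitely many. -/
noncomputable def homCount (S : Type*) [Semiring S]
    (T : LTS.{uP, uI, w} P I) (M : LTS.{uP, uI, u} P I) : S :=
  Nat.card (Hom T M) • (1 : S)

/-- The left homomorphism vector of `M` over `S`, restricted to the class `C`. -/
noncomputable def leftProfile (S : Type*) [Semiring S]
    (C : Set (LTS.{uP, uI, w} P I)) (M : LTS.{uP, uI, u} P I) : C → S :=
  fun T => homCount S T.1 M

/-- The domain of the generated submodel: the smallest set of states that contains the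
distinguished one and is closed under transitions. -/
def genSet (M : LTS.{uP, uI, u} P I) : Set M.State :=
  ⋂₀ {X | M.pt ∈ X ∧ ∀ b ∈ X, ∀ i c, M.rel i b c → c ∈ X}

/-- The submodel generated by the distinguished state. -/
def gsub (M : LTS.{uP, uI, u} P I) : LTS.{uP, uI, u} P I where
  State := M.genSet
  val p m := M.val p m
  rel i m n := M.rel i m n
  pt := ⟨M.pt, fun _ hX => hX.1⟩

end LTS

/-- Formulas of nominal-free hybrid logic with `↓` and `@`; world variables are natural numbers. -/
inductive HLFormula (P : Type uP) (I : Type uI) where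
  | prop : P → HLFormula P I
  | wvar : ℕ → HLFormula P I
  | and : HLFormula P I → HLFormula P I → HLFormula P I
  | or : HLFormula P I → HLFormula P I → HLFormula P I
  | not : HLFormula P I → HLFormula P I
  | dia : I → HLFormula P I → HLFormula P I
  | box : I → HLFormula P I → HLFormula P I
  | down : ℕ → HLFormula P I → HLFormula P I
  | atVar : ℕ → HLFormula P I → HLFormula P I

namespace HLFormula

variable {P : Type uP} {I : Type uI}

/-- The free world variables. -/
def free : HLFormula P I → Set ℕ
  | prop _ => ∅
  | wvar x => {x}
  | and φ ψ => φ.free ∪ ψ.free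
  | or φ ψ => φ.free ∪ ψ.free
  | not φ => φ.free
  | dia _ φ => φ.free
  | box _ φ => φ.free
  | down x φ => φ.free \ {x}
  | atVar x φ => insert x φ.free

def IsSentence (φ : HLFormula P I) : Prop := φ.free = ∅

/-- Satisfaction at the state `m` under the assignment `g`. -/
def Sat (M : LTS.{uP, uI, u} P I) : (ℕ → M.State) → M.State → HLFormula P I → Prop
  | _, m, prop p => M.val p m
  | g, m, wvar x => g x = m
  | g, m, and φ ψ => Sat M g m φ ∧ Sat M g m ψ
  | g, m, or φ ψ => Sat M g m φ ∨ Sat M g m ψ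
  | g, m, not φ => ¬ Sat M g m φ
  | g, m, dia i φ => ∃ n, M.rel i m n ∧ Sat M g n φ
  | g, m, box i φ => ∀ n, M.rel i m n → Sat M g n φ
  | g, m, down x φ => Sat M (Function.update g x m) m φ
  | g, _, atVar x φ => Sat M g (g x) φ

theorem sat_congr (M : LTS.{uP, uI, u} P I) (φ : HLFormula P I) :
    ∀ (g h : ℕ → M.State) (m : M.State), (∀ x ∈ φ.free, g x = h x) →
      (Sat M g m φ ↔ Sat M h m φ) := by
  induction φ with
  | prop p => intro g h m _; rfl
  | wvar x => intro g h m H; simp only [Sat, H x rfl]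
  | and φ ψ ih₁ ih₂ =>
    intro g h m H
    simp only [Sat, ih₁ g h m (fun x hx => H x (Or.inl hx)),
      ih₂ g h m (fun x hx => H x (Or.inr hx))]
  | or φ ψ ih₁ ih₂ =>
    intro g h m H
    simp only [Sat, ih₁ g h m (fun x hx => H x (Or.inl hx)),
      ih₂ g h m (fun x hx => H x (Or.inr hx))]
  | not φ ih => intro g h m H; simp only [Sat, ih g h m H]
  | dia i φ ih => intro g h m H; simp only [Sat, ih g h _ H]
  | box i φ ih => intro g h m H; simp only [Sat, ih g h _ H]
  | down x φ ih =>
    intro g h m H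
    refine ih _ _ m (fun y hy => ?_)
    by_cases hyx : y = x
    · subst hyx; simp
    · simpa [Function.update_of_ne hyx] using H y ⟨hy, hyx⟩
  | atVar x φ ih =>
    intro g h m H
    simp only [Sat, H x (Or.inl rfl)]
    exact ih g h _ (fun y hy => H y (Or.inr hy))

/-- Truth of a sentence at the distinguished state. -/
def Holds (M : LTS.{uP, uI, u} P I) (φ : HLFormula P I) : Prop :=
  ∀ g : ℕ → M.State, Sat M g M.pt φ

/-- For sentences the assignment does not matter. -/
theorem holds_iff (M : LTS.{uP, uI, u} P I) (φ : HLFormula P I) (hφ : φ.IsSentence)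
    (g : ℕ → M.State) : Holds M φ ↔ Sat M g M.pt φ := by
  refine ⟨fun H => H g, fun H h => (sat_congr M φ g h M.pt ?_).1 H⟩
  intro x hx
  rw [show φ.free = ∅ from hφ] at hx
  exact hx.elim

end HLFormula

/-- Equivalence of LTSs with respect to sentences of nominal-free hybrid logic. -/
def HLEquiv {P : Type uP} {I : Type uI}
    (M : LTS.{uP, uI, u} P I) (N : LTS.{uP, uI, v} P I) : Prop :=
  ∀ φ : HLFormula P I, φ.IsSentence → (φ.Holds M ↔ φ.Holds N)

namespace LTS

variable {P : Type uP} {I : Type uI}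

section Embedding

variable {M : LTS.{uP, uI, u} P I} {N : LTS.{uP, uI, v} P I} {T : LTS.{uP, uI, w} P I}

theorem Hom.toFun_injective : Function.Injective (Hom.toFun : Hom M N → M.State → N.State) := by
  rintro ⟨f, _, _, _⟩ ⟨g, _, _, _⟩ h
  cases h
  rfl

/-- Composition of homomorphisms. -/
def Hom.comp (g : Hom M N) (f : Hom T M) : Hom T N where
  toFun t := g.toFun (f.toFun t)
  map_pt := by rw [f.map_pt, g.map_pt]
  map_val p _ h := g.map_val p _ (f.map_val p _ h)
  map_rel i _ _ h := g.map_rel i _ _ (f.map_rel i _ _ h)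

/-- Iterates of an endomorphism. -/
def Hom.iterate (f : Hom M M) (n : ℕ) : Hom M M where
  toFun := f.toFun^[n]
  map_pt := Function.iterate_fixed f.map_pt n
  map_val p _ h := Function.Iterate.rec (M.val p) h (f.map_val p) n
  map_rel i m m' h := by
    induction n generalizing m m' with
    | zero => exact h
    | succ _ ih => exact ih _ _ (f.map_rel i m m' h)

theorem Hom.reflTransGen_map (f : Hom M N) {m n : M.State}
    (h : Relation.ReflTransGen M.Step m n) :
    Relation.ReflTransGen N.Step (f.toFun m) (f.toFun n) :=
  h.lift f.toFun fun a b ⟨i, hab⟩ => ⟨i, f.map_rel i a b hab⟩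

/-- Injective homomorphisms. They need not reflect the propositions and transitions of the target,
unlike embeddings. -/
def InjHom (M : LTS.{uP, uI, u} P I) (N : LTS.{uP, uI, v} P I) :=
  {f : Hom M N // Function.Injective f.toFun}

/-- Embeddings in the sense of model theory: injective homomorphisms that reflect propositions
and transitions. -/
structure Hom.IsEmbedding (f : Hom M N) : Prop where
  injective : Function.Injective f.toFun
  val_iff : ∀ p m, N.val p (f.toFun m) ↔ M.val p m
  rel_iff : ∀ i m n, N.rel i (f.toFun m) (f.toFun n) ↔ M.rel i m n

theorem Hom.isEmbedding_of_exists_inverse_on_pairs (f : Hom M N)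
    (h : ∀ m n, ∃ g : Hom N M, g.toFun (f.toFun m) = m ∧ g.toFun (f.toFun n) = n) :
    f.IsEmbedding where
  injective m n hmn := by
    obtain ⟨g, hm, hn⟩ := h m n
    rw [← hm, hmn, hn]
  val_iff p m := by
    obtain ⟨g, hm, -⟩ := h m m
    exact ⟨fun hp => hm ▸ g.map_val p _ hp, f.map_val p m⟩
  rel_iff i m n := by
    obtain ⟨g, hm, hn⟩ := h m n
    refine ⟨fun hr => ?_, f.map_rel i m n⟩
    simpa only [hm, hn] using g.map_rel i _ _ hr

theorem Hom.IsEmbedding.isomorphic {f : Hom M N} (hf : f.IsEmbedding)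
    (hsurj : Function.Surjective f.toFun) : Isomorphic M N := by
  obtain ⟨g, hg⟩ := hsurj.hasRightInverse
  refine ⟨f, ⟨g, ?_, fun p n hp => ?_, fun i n n' hr => ?_⟩, fun m => hf.injective (hg _), hg⟩
  · exact hf.injective ((hg _).trans f.map_pt.symm)
  · rwa [← hf.val_iff, hg]
  · rwa [← hf.rel_iff, hg, hg]

theorem Isomorphic.exists_isEmbedding_surjective (h : Isomorphic M N) :
    ∃ f : Hom M N, f.IsEmbedding ∧ Function.Surjective f.toFun := by
  obtain ⟨f, g, hgf, hfg⟩ := h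
  exact ⟨f, f.isEmbedding_of_exists_inverse_on_pairs fun m n => ⟨g, hgf m, hgf n⟩,
    hfg.surjective⟩

theorem Isomorphic.card_hom_eq (h : Isomorphic M N) (T : LTS.{uP, uI, w} P I) :
    Nat.card (Hom T M) = Nat.card (Hom T N) := by
  obtain ⟨f, g, hgf, hfg⟩ := h
  exact Nat.card_congr ⟨f.comp, g.comp,
    fun k => Hom.toFun_injective (funext fun t => hgf (k.toFun t)),
    fun k => Hom.toFun_injective (funext fun t => hfg (k.toFun t))⟩

theorem Hom.exists_inverse_on_pair_of_periodic (f : Hom M N) (g : Hom N M) {m n : M.State}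
    (hm : m ∈ Function.periodicPts (g.comp f).toFun)
    (hn : n ∈ Function.periodicPts (g.comp f).toFun) :
    ∃ r : Hom N M, r.toFun (f.toFun m) = m ∧ r.toFun (f.toFun n) = n := by
  obtain ⟨j, hj, hm⟩ := hm
  obtain ⟨k, hk, hn⟩ := hn
  obtain ⟨q, hq⟩ : ∃ q, j * k = q + 1 := Nat.exists_eq_succ_of_ne_zero (Nat.mul_pos hj hk).ne'
  have hm' : Function.IsPeriodicPt (g.comp f).toFun (q + 1) m := hq ▸ hm.mul_const k
  have hn' : Function.IsPeriodicPt (g.comp f).toFun (q + 1) n := hq ▸ hn.const_mul j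
  exact ⟨((g.comp f).iterate q).comp g, hm', hn'⟩

theorem isomorphic_of_injective_of_periodic (f : Hom M N) (g : Hom N M)
    (hg : Function.Injective g.toFun) (h : ∀ m, m ∈ Function.periodicPts (g.comp f).toFun) :
    Isomorphic M N := by
  have hf : f.IsEmbedding := f.isEmbedding_of_exists_inverse_on_pairs fun m n =>
    f.exists_inverse_on_pair_of_periodic g (h m) (h n)
  refine hf.isomorphic fun n => ?_
  obtain ⟨k, hk, hper⟩ := h (g.toFun n)
  obtain ⟨q, rfl⟩ := Nat.exists_eq_succ_of_ne_zero hk.ne'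
  refine ⟨(g.comp f).toFun^[q] (g.toFun n), hg ?_⟩
  exact (Function.iterate_succ_apply' _ _ _).symm.trans hper

end Embedding

section Ball

variable {M : LTS.{uP, uI, u} P I} {N : LTS.{uP, uI, v} P I}

/-- The induced submodel on a set of states that contains the distinguished one. -/
def restrict (M : LTS.{uP, uI, u} P I) (S : Set M.State) (hS : M.pt ∈ S) :
    LTS.{uP, uI, u} P I where
  State := S
  val p m := M.val p m
  rel i m n := M.rel i m n
  pt := ⟨M.pt, hS⟩

/-- The inclusion of an induced submodel. -/
def restrictInclusion (M : LTS.{uP, uI, u} P I) (S : Set M.State) (hS : M.pt ∈ S) :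
    Hom (M.restrict S hS) M where
  toFun := Subtype.val
  map_pt := rfl
  map_val _ _ h := h
  map_rel _ _ _ h := h

theorem isEmbedding_restrictInclusion (S : Set M.State) (hS : M.pt ∈ S) :
    (M.restrictInclusion S hS).IsEmbedding :=
  ⟨Subtype.val_injective, fun _ _ => Iff.rfl, fun _ _ _ => Iff.rfl⟩

/-- The states reached from the distinguished one in at most `d` transitions. -/
def ball (M : LTS.{uP, uI, u} P I) : ℕ → Set M.State
  | 0 => {M.pt}
  | d + 1 => M.ball d ∪ ⋃ m ∈ M.ball d, M.succ m

theorem ball_mono : Monotone M.ball :=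
  monotone_nat_of_le_succ fun _ => Set.subset_union_left

theorem pt_mem_ball (d : ℕ) : M.pt ∈ M.ball d :=
  ball_mono (Nat.zero_le d) rfl

theorem mem_ball_succ_of_step {d : ℕ} {m n : M.State} (hm : m ∈ M.ball d) (h : M.Step m n) :
    n ∈ M.ball (d + 1) :=
  Or.inr (Set.mem_biUnion hm h)

theorem ball_induction {motive : ∀ (d : ℕ) (m : M.State), m ∈ M.ball d → Prop}
    (zero : motive 0 M.pt rfl)
    (stay : ∀ d m (hm : m ∈ M.ball d), motive d m hm → motive (d + 1) m (Or.inl hm))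
    (step : ∀ d m n (hm : m ∈ M.ball d) (h : M.Step m n), motive d m hm →
      motive (d + 1) n (mem_ball_succ_of_step hm h))
    {d : ℕ} {m : M.State} (hm : m ∈ M.ball d) : motive d m hm := by
  induction d generalizing m with
  | zero => cases hm; exact zero
  | succ d ih =>
    rcases hm with hm | hm
    · exact stay d m hm (ih hm)
    · obtain ⟨n, hn, h⟩ := Set.mem_iUnion₂.1 hm
      exact step d n m hn h (ih hn)

theorem reflTransGen_of_mem_ball {d : ℕ} {m : M.State} (hm : m ∈ M.ball d) :
    Relation.ReflTransGen M.Step M.pt m :=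
  ball_induction (motive := fun _ m _ => Relation.ReflTransGen M.Step M.pt m) .refl
    (fun _ _ _ ih => ih) (fun _ _ _ _ h ih => ih.tail h) hm

theorem exists_mem_ball {m : M.State} (h : Relation.ReflTransGen M.Step M.pt m) :
    ∃ d, m ∈ M.ball d := by
  induction h with
  | refl => exact ⟨0, rfl⟩
  | tail _ hstep ih =>
    obtain ⟨d, hd⟩ := ih
    exact ⟨d + 1, mem_ball_succ_of_step hd hstep⟩

theorem ImageFinite.finite_ball (hM : M.ImageFinite) (d : ℕ) : (M.ball d).Finite := by
  induction d with
  | zero => exact Set.finite_singleton _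
  | succ d ih => exact ih.union (ih.biUnion fun m _ => hM m)

theorem Hom.mapsTo_ball (f : Hom M N) (d : ℕ) : Set.MapsTo f.toFun (M.ball d) (N.ball d) :=
  fun _ hm => ball_induction (motive := fun d m _ => f.toFun m ∈ N.ball d) f.map_pt
    (fun _ _ _ ih => Or.inl ih)
    (fun _ _ _ _ ⟨i, h⟩ ih => mem_ball_succ_of_step ih ⟨i, f.map_rel i _ _ h⟩) hm

/-- The submodel on the states reached in at most `d` transitions. -/
abbrev ballModel (M : LTS.{uP, uI, u} P I) (d : ℕ) : LTS.{uP, uI, u} P I :=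
  M.restrict (M.ball d) (pt_mem_ball d)

theorem mem_ball_ballModel {d k : ℕ} (hk : k ≤ d) {m : M.State} (hm : m ∈ M.ball k) :
    (⟨m, ball_mono hk hm⟩ : (M.ballModel d).State) ∈ (M.ballModel d).ball k :=
  ball_induction (motive := fun k m hm => ∀ hk : k ≤ d,
      (⟨m, ball_mono hk hm⟩ : (M.ballModel d).State) ∈ (M.ballModel d).ball k)
    (fun _ => rfl) (fun k _ _ ih hk => Or.inl (ih (k.le_succ.trans hk)))
    (fun k _ _ _ h ih hk => mem_ball_succ_of_step (ih (k.le_succ.trans hk)) h) hm hk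

theorem pointGenerated_ballModel (d : ℕ) : (M.ballModel d).PointGenerated := fun m =>
  reflTransGen_of_mem_ball (mem_ball_ballModel le_rfl m.2)

theorem PointGenerated.finite_hom [Finite M.State] (hM : M.PointGenerated)
    (hN : N.ImageFinite) : Finite (Hom M N) := by
  choose d hd using fun m => exists_mem_ball (hM m)
  have (m : M.State) : Finite (N.ball (d m)) := hN.finite_ball (d m)
  exact Finite.of_injective
    (fun (f : Hom M N) m => (⟨f.toFun m, f.mapsTo_ball _ (hd m)⟩ : N.ball (d m)))
    fun f g h => Hom.toFun_injective (funext fun m => congrArg Subtype.val (congrFun h m))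

end Ball

section Compactness

variable {M : LTS.{uP, uI, u} P I} {N : LTS.{uP, uI, v} P I}

theorem exists_map_eq_hom_ballModel_on_finset (hM : M.PointGenerated) (hN : N.ImageFinite)
    (f : ∀ d, Hom (M.ballModel d) N) :
    ∃ F : M.State → N.State, ∀ s : Finset M.State,
      ∃ d, ∀ m ∈ s, ∃ hm : m ∈ M.ball d, F m = (f d).toFun ⟨m, hm⟩ := by
  choose rank hrank using fun m => exists_mem_ball (hM m)
  have (m : M.State) : Finite (N.ball (rank m)) := hN.finite_ball (rank m)
  have hle {s : Finset M.State} {m : M.State} (hm : m ∈ s) : rank m ≤ s.sup rank :=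
    Finset.le_sup hm
  obtain ⟨F, hF⟩ := Finset.rado_selection_subtype (β := fun m => N.ball (rank m)) fun s m =>
    ⟨(f (s.sup rank)).toFun ⟨m, ball_mono (hle m.2) (hrank m)⟩,
      (f _).mapsTo_ball _ (mem_ball_ballModel (hle m.2) (hrank m))⟩
  refine ⟨fun m => (F m).1, fun s => ?_⟩
  obtain ⟨t, hst, hFt⟩ := hF s
  exact ⟨t.sup rank, fun m hm => ⟨ball_mono (hle (hst hm)) (hrank m),
    congrArg Subtype.val (hFt ⟨m, hm⟩)⟩⟩

theorem nonempty_injHom_of_ballModel (hM : M.PointGenerated) (hN : N.ImageFinite)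
    (h : ∀ d, Nonempty (InjHom (M.ballModel d) N)) : Nonempty (InjHom M N) := by
  classical
  obtain ⟨f⟩ := Classical.nonempty_pi.2 h
  obtain ⟨F, hF⟩ := exists_map_eq_hom_ballModel_on_finset hM hN fun d => (f d).1
  have hpair (m n : M.State) : ∃ d, ∃ (hm : m ∈ M.ball d) (hn : n ∈ M.ball d),
      F m = (f d).1.toFun ⟨m, hm⟩ ∧ F n = (f d).1.toFun ⟨n, hn⟩ := by
    obtain ⟨d, hd⟩ := hF {m, n}
    obtain ⟨hm, hFm⟩ := hd m (by simp)
    obtain ⟨hn, hFn⟩ := hd n (by simp)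
    exact ⟨d, hm, hn, hFm, hFn⟩
  refine ⟨⟨F, ?_, fun p m hp => ?_, fun i m n hr => ?_⟩, fun m n hmn => ?_⟩
  · obtain ⟨d, _, -, hpt, -⟩ := hpair M.pt M.pt
    exact hpt.trans (f d).1.map_pt
  · obtain ⟨d, hm, -, hFm, -⟩ := hpair m m
    exact hFm ▸ (f d).1.map_val p ⟨m, hm⟩ hp
  · obtain ⟨d, hm, hn, hFm, hFn⟩ := hpair m n
    exact hFm ▸ hFn ▸ (f d).1.map_rel i ⟨m, hm⟩ ⟨n, hn⟩ hr
  · obtain ⟨d, hm, hn, hFm, hFn⟩ := hpair m n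
    exact congrArg Subtype.val ((f d).2 (hFm.symm.trans (hmn.trans hFn)))

theorem PointGenerated.mem_periodicPts_of_injective (hM : M.PointGenerated)
    (hfin : M.ImageFinite) {e : Hom M M} (he : Function.Injective e.toFun) (m : M.State) :
    m ∈ Function.periodicPts e.toFun := by
  obtain ⟨d, hm⟩ := exists_mem_ball (hM m)
  have : Finite (M.ball d) := hfin.finite_ball d
  have hmaps := e.mapsTo_ball d
  obtain ⟨k, hk, hper⟩ := (hmaps.restrict_inj.2 he.injOn).mem_periodicPts ⟨m, hm⟩
  exact ⟨k, hk, hper.map (g := Subtype.val) fun _ => rfl⟩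

theorem isomorphic_of_ballModel_injHom (hM : M.PointGenerated) (hN : N.PointGenerated)
    (hMfin : M.ImageFinite) (hNfin : N.ImageFinite)
    (hMN : ∀ d, Nonempty (InjHom (M.ballModel d) N))
    (hNM : ∀ d, Nonempty (InjHom (N.ballModel d) M)) : Isomorphic M N := by
  obtain ⟨F, hF⟩ := nonempty_injHom_of_ballModel hM hNfin hMN
  obtain ⟨G, hG⟩ := nonempty_injHom_of_ballModel hN hMfin hNM
  exact isomorphic_of_injective_of_periodic F G hG
    (hM.mem_periodicPts_of_injective hMfin (e := G.comp F) (hG.comp hF))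

end Compactness

section Counting

variable {M : LTS.{uP, uI, u} P I} {N : LTS.{uP, uI, v} P I} {T : LTS.{uP, uI, w} P I}

/-- The quotient of `T` by an equivalence relation, with the fewest propositions and transitions
that make the projection a homomorphism. -/
def quot (T : LTS.{uP, uI, w} P I) (s : Setoid T.State) : LTS.{uP, uI, w} P I where
  State := Quotient s
  val p q := ∃ t, Quotient.mk s t = q ∧ T.val p t
  rel i q r := ∃ t t', Quotient.mk s t = q ∧ Quotient.mk s t' = r ∧ T.rel i t t'
  pt := Quotient.mk s T.pt

/-- The projection onto a quotient. -/
def quotMk (T : LTS.{uP, uI, w} P I) (s : Setoid T.State) : Hom T (T.quot s) where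
  toFun := Quotient.mk s
  map_pt := rfl
  map_val _ t h := ⟨t, rfl, h⟩
  map_rel _ t t' h := ⟨t, t', rfl, rfl, h⟩

/-- The homomorphism on a quotient induced by one that is constant on the classes. -/
def Hom.quotLift (f : Hom T M) {s : Setoid T.State} (hs : s ≤ Setoid.ker f.toFun) :
    Hom (T.quot s) M where
  toFun := Quotient.lift f.toFun fun _ _ h => hs h
  map_pt := f.map_pt
  map_val := by
    rintro p _ ⟨t, rfl, h⟩
    exact f.map_val p t h
  map_rel := by
    rintro i _ _ ⟨a, b, rfl, rfl, h⟩
    exact f.map_rel i a b h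

/-- Homomorphisms with kernel `s` correspond to injective homomorphisms on the quotient by `s`. -/
def homKerEquivInjHomQuot (T : LTS.{uP, uI, w} P I) (M : LTS.{uP, uI, u} P I)
    (s : Setoid T.State) : {f : Hom T M // Setoid.ker f.toFun = s} ≃ InjHom (T.quot s) M where
  toFun f := ⟨f.1.quotLift f.2.ge, (Setoid.lift_injective_iff_ker_eq_of_le f.2.ge).2 f.2⟩
  invFun f := ⟨f.1.comp (T.quotMk s), Setoid.ext fun _ _ => f.2.eq_iff.trans Quotient.eq⟩
  left_inv _ := rfl
  right_inv _ := Subtype.ext (Hom.toFun_injective (funext (Quotient.ind fun _ => rfl)))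

theorem finite_setoid (α : Type*) [Finite α] : Finite (Setoid α) :=
  Finite.of_injective (fun s : Setoid α => s.r) fun _ _ => Setoid.eq_iff_rel_eq.2

theorem card_hom_eq_card_injHom_add_sum [Fintype (Setoid T.State)]
    [DecidableEq (Setoid T.State)] [Finite (Hom T M)] :
    Nat.card (Hom T M) =
      Nat.card (InjHom T M) + ∑ s ∈ Finset.univ.erase ⊥, Nat.card (InjHom (T.quot s) M) := by
  have hbot : Nat.card {f : Hom T M // Setoid.ker f.toFun = ⊥} = Nat.card (InjHom T M) :=
    Nat.card_congr (Equiv.subtypeEquivRight fun f => (Setoid.injective_iff_ker_bot f.toFun).symm)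
  rw [← Nat.card_congr (Equiv.sigmaFiberEquiv fun f : Hom T M => Setoid.ker f.toFun),
    Nat.card_sigma, ← Finset.add_sum_erase _ _ (Finset.mem_univ ⊥), hbot]
  simp only [Nat.card_congr (homKerEquivInjHomQuot T M _)]

theorem card_state_quot_lt [Finite T.State] {s : Setoid T.State} (hs : s ≠ ⊥) :
    Nat.card (T.quot s).State < Nat.card T.State := by
  refine (Nat.card_le_card_of_surjective _ (Quotient.mk_surjective (s := s))).lt_of_ne
    fun hcard => hs ?_
  have hbij := (Nat.bijective_iff_surjective_and_card (Quotient.mk s)).2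
    ⟨Quotient.mk_surjective, hcard.symm⟩
  exact eq_bot_iff.2 fun a b hab => hbij.1 (Quotient.sound hab)

theorem PointGenerated.of_surjective (hM : M.PointGenerated) (f : Hom M N)
    (hf : Function.Surjective f.toFun) : N.PointGenerated :=
  hf.forall.2 fun m => f.map_pt ▸ f.reflTransGen_map (hM m)

theorem quot_mem_PG (hT : T ∈ PG P I) (s : Setoid T.State) : T.quot s ∈ PG P I :=
  have := hT.1
  ⟨inferInstanceAs (Finite (Quotient s)),
    hT.2.of_surjective (T.quotMk s) Quotient.mk_surjective⟩

theorem card_injHom_eq_of_card_hom_eq (hM : M.ImageFinite) (hN : N.ImageFinite)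
    (h : ∀ T ∈ PG.{uP, uI, w} P I, Nat.card (Hom T M) = Nat.card (Hom T N))
    (hT : T ∈ PG P I) : Nat.card (InjHom T M) = Nat.card (InjHom T N) := by
  classical
  induction hn : Nat.card T.State using Nat.strong_induction_on generalizing T with
  | _ n ih =>
    subst hn
    have := hT.1
    have := finite_setoid T.State
    have := Fintype.ofFinite (Setoid T.State)
    have := hT.2.finite_hom hM
    have := hT.2.finite_hom hN
    have hquot : ∀ s ∈ Finset.univ.erase (⊥ : Setoid T.State),
        Nat.card (InjHom (T.quot s) M) = Nat.card (InjHom (T.quot s) N) := fun s hs =>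
      ih _ (card_state_quot_lt (Finset.ne_of_mem_erase hs)) (quot_mem_PG hT s) rfl
    have hcount := h T hT
    rwa [card_hom_eq_card_injHom_add_sum, card_hom_eq_card_injHom_add_sum,
      Finset.sum_congr rfl hquot, Nat.add_right_cancel_iff] at hcount

/-- The copy of a structure along a bijection of the states. -/
def transport (M : LTS.{uP, uI, u} P I) {α : Type w} (e : α ≃ M.State) : LTS.{uP, uI, w} P I where
  State := α
  val p a := M.val p (e a)
  rel i a b := M.rel i (e a) (e b)
  pt := e.symm M.pt

theorem transport_isomorphic (M : LTS.{uP, uI, u} P I) {α : Type w} (e : α ≃ M.State) :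
    Isomorphic (M.transport e) M :=
  Hom.IsEmbedding.isomorphic
    (f := ⟨e, e.apply_symm_apply _, fun _ _ h => h, fun _ _ _ h => h⟩)
    ⟨e.injective, fun _ _ => Iff.rfl, fun _ _ _ => Iff.rfl⟩ e.surjective

theorem exists_mem_PG_isomorphic [Finite M.State] (hM : M.PointGenerated) :
    ∃ T ∈ PG.{uP, uI, w} P I, Isomorphic T M := by
  let e : ULift.{w} (Fin (Nat.card M.State)) ≃ M.State :=
    Equiv.ulift.trans (Finite.equivFin _).symm
  have hiso := M.transport_isomorphic e
  obtain ⟨f, g, hgf, -⟩ := id hiso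
  exact ⟨M.transport e, ⟨inferInstanceAs (Finite (ULift (Fin _))),
    hM.of_surjective g hgf.surjective⟩, hiso⟩

theorem nonempty_injHom_of_card_hom_eq (hM : M.ImageFinite) (hN : N.ImageFinite)
    (h : ∀ T ∈ PG.{uP, uI, w} P I, Nat.card (Hom T M) = Nat.card (Hom T N)) (d : ℕ) :
    Nonempty (InjHom (M.ballModel d) N) := by
  have : Finite (M.ballModel d).State := hM.finite_ball d
  obtain ⟨T, hT, f, g, hgf, hfg⟩ :=
    exists_mem_PG_isomorphic.{uP, uI, u, w} (pointGenerated_ballModel (M := M) d)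
  have := hT.1
  have := hT.2.finite_hom hM
  have hne : Nonempty (InjHom T M) :=
    ⟨(M.restrictInclusion _ _).comp f, Subtype.val_injective.comp hgf.injective⟩
  have hpos : 0 < Nat.card (InjHom T M) :=
    Nat.card_pos_iff.2 ⟨hne, inferInstanceAs (Finite (Subtype _))⟩
  rw [card_injHom_eq_of_card_hom_eq hM hN h hT] at hpos
  obtain ⟨k, hk⟩ := (Nat.card_pos_iff.1 hpos).1
  exact ⟨k.comp g, hk.comp hfg.injective⟩

theorem isomorphic_of_card_hom_eq (hM : M.PointGenerated) (hN : N.PointGenerated)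
    (hMfin : M.ImageFinite) (hNfin : N.ImageFinite)
    (h : ∀ T ∈ PG.{uP, uI, w} P I, Nat.card (Hom T M) = Nat.card (Hom T N)) : Isomorphic M N :=
  isomorphic_of_ballModel_injHom hM hN hMfin hNfin (nonempty_injHom_of_card_hom_eq hMfin hNfin h)
    (nonempty_injHom_of_card_hom_eq hNfin hMfin fun T hT => (h T hT).symm)

theorem leftProfile_nat_eq_iff (C : Set (LTS.{uP, uI, w} P I)) :
    leftProfile ℕ C M = leftProfile ℕ C N ↔
      ∀ T ∈ C, Nat.card (Hom T M) = Nat.card (Hom T N) := by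
  simp [funext_iff, leftProfile, homCount]

end Counting

section GeneratedSubmodel

variable {M : LTS.{uP, uI, u} P I} {T : LTS.{uP, uI, w} P I}

theorem mem_genSet_of_step {m n : M.State} (hm : m ∈ M.genSet) (h : M.Step m n) :
    n ∈ M.genSet := fun X hX => h.elim fun i hi => hX.2 m (hm X hX) i n hi

/-- The inclusion of the generated submodel. -/
def gsubInclusion (M : LTS.{uP, uI, u} P I) : Hom M.gsub M :=
  M.restrictInclusion M.genSet M.gsub.pt.2

theorem pointGenerated_gsub : M.gsub.PointGenerated := fun m => by
  obtain ⟨_, h⟩ : ∃ hm, Relation.ReflTransGen M.gsub.Step M.gsub.pt ⟨m.1, hm⟩ :=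
    m.2 {a | ∃ ha, Relation.ReflTransGen M.gsub.Step M.gsub.pt ⟨a, ha⟩}
      ⟨⟨M.gsub.pt.2, .refl⟩, fun _ ⟨hb, h⟩ i _ hi => ⟨mem_genSet_of_step hb ⟨i, hi⟩,
        h.tail ⟨i, hi⟩⟩⟩
  exact h

theorem ImageFinite.gsub (hM : M.ImageFinite) : M.gsub.ImageFinite := fun m =>
  Set.Finite.preimage (f := Subtype.val) (s := M.succ m.1) Subtype.val_injective.injOn
    (hM m.1)

theorem Hom.apply_mem_genSet (f : Hom T M) (hT : T.PointGenerated) (t : T.State) :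
    f.toFun t ∈ M.genSet := by
  induction hT t with
  | refl => exact f.map_pt ▸ M.gsub.pt.2
  | tail _ h ih => exact mem_genSet_of_step ih (h.imp fun i => f.map_rel i _ _)

/-- Homomorphisms from a point-generated structure take values in the generated submodel. -/
def homEquivHomGsub (hT : T.PointGenerated) : Hom T M ≃ Hom T M.gsub where
  toFun f :=
    { toFun := fun t => ⟨f.toFun t, f.apply_mem_genSet hT t⟩
      map_pt := Subtype.ext f.map_pt
      map_val := f.map_val
      map_rel := f.map_rel }
  invFun := M.gsubInclusion.comp
  left_inv _ := rfl
  right_inv _ := rfl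

end GeneratedSubmodel

end LTS

section HybridLogic

open LTS HLFormula

variable {P : Type uP} {I : Type uI} {M : LTS.{uP, uI, u} P I} {N : LTS.{uP, uI, v} P I}

theorem HLEquiv.symm (h : HLEquiv M N) : HLEquiv N M := fun φ hφ => (h φ hφ).symm

theorem HLEquiv.trans {K : LTS.{uP, uI, w} P I} (h : HLEquiv M N) (h' : HLEquiv N K) :
    HLEquiv M K := fun φ hφ => (h φ hφ).trans (h' φ hφ)

theorem LTS.Hom.IsEmbedding.sat_iff {f : Hom M N} (hf : f.IsEmbedding)
    (hsucc : ∀ m n, N.Step (f.toFun m) n → n ∈ Set.range f.toFun) (φ : HLFormula P I)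
    (g : ℕ → M.State) (m : M.State) : Sat M g m φ ↔ Sat N (f.toFun ∘ g) (f.toFun m) φ := by
  induction φ generalizing g m with
  | prop p => exact (hf.val_iff p m).symm
  | wvar x => exact hf.injective.eq_iff.symm
  | and φ ψ ihφ ihψ => exact and_congr (ihφ g m) (ihψ g m)
  | or φ ψ ihφ ihψ => exact or_congr (ihφ g m) (ihψ g m)
  | not φ ih => exact not_congr (ih g m)
  | dia i φ ih =>
    constructor
    · rintro ⟨n, hn, h⟩
      exact ⟨f.toFun n, f.map_rel i m n hn, (ih g n).1 h⟩
    · rintro ⟨_, hn, h⟩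
      obtain ⟨n, rfl⟩ := hsucc m _ ⟨i, hn⟩
      exact ⟨n, (hf.rel_iff i m n).1 hn, (ih g n).2 h⟩
  | box i φ ih =>
    refine ⟨fun h n' hn => ?_, fun h n hn => (ih g n).2 (h _ (f.map_rel i m n hn))⟩
    obtain ⟨n, rfl⟩ := hsucc m n' ⟨i, hn⟩
    exact (ih g n).1 (h n ((hf.rel_iff i m n).1 hn))
  | down x φ ih => rw [Sat, Sat, ih, Function.comp_update]
  | atVar x _ ih => exact ih g (g x)

theorem LTS.Hom.IsEmbedding.hlEquiv {f : Hom M N} (hf : f.IsEmbedding)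
    (hsucc : ∀ m n, N.Step (f.toFun m) n → n ∈ Set.range f.toFun) : HLEquiv M N := fun φ hφ => by
  rw [holds_iff M φ hφ fun _ => M.pt, holds_iff N φ hφ (f.toFun ∘ fun _ => M.pt),
    hf.sat_iff hsucc, f.map_pt]

theorem hlEquiv_gsub (M : LTS.{uP, uI, u} P I) : HLEquiv M.gsub M :=
  Hom.IsEmbedding.hlEquiv (f := M.gsubInclusion) (isEmbedding_restrictInclusion _ _)
    fun m n h => ⟨⟨n, mem_genSet_of_step m.2 h⟩, rfl⟩

theorem LTS.Isomorphic.hlEquiv (h : Isomorphic M N) : HLEquiv M N := by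
  obtain ⟨f, hf, hsurj⟩ := h.exists_isEmbedding_surjective
  exact hf.hlEquiv fun _ n _ => hsurj n

theorem exists_separating_formula {ι : Type*} {X : Set ℕ} {g : ℕ → M.State} {m : M.State}
    {h : ι → ℕ → N.State} {n : ι → N.State} {S : Set ι} (hS : S.Finite)
    (hsep : ∀ j ∈ S, ∃ φ : HLFormula P I, φ.free ⊆ X ∧ Sat M g m φ ∧ ¬ Sat N (h j) (n j) φ) :
    ∃ φ : HLFormula P I, φ.free ⊆ X ∧ Sat M g m φ ∧ ∀ j ∈ S, ¬ Sat N (h j) (n j) φ := by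
  induction S, hS using Set.Finite.induction_on with
  | empty => exact ⟨down 0 (wvar 0), by simp [free], by simp [Sat], by simp⟩
  | @insert j S _ _ ih =>
    obtain ⟨φ, hφX, hφ, hφS⟩ := ih fun k hk => hsep k (Or.inr hk)
    obtain ⟨ψ, hψX, hψ, hψj⟩ := hsep j (Or.inl rfl)
    refine ⟨and φ ψ, Set.union_subset hφX hψX, ⟨hφ, hψ⟩, ?_⟩
    rintro k (rfl | hk) ⟨hφk, hψk⟩
    exacts [hψj hψk, hφS k hk hφk]

/-- The tuples named by the first `l` world variables in `M` and in `N`, starting with the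
distinguished states, satisfy the same formulas. -/
structure HLMatching (M : LTS.{uP, uI, u} P I) (N : LTS.{uP, uI, v} P I) (l : ℕ)
    (g : ℕ → M.State) (h : ℕ → N.State) : Prop where
  pos : 0 < l
  left_zero : g 0 = M.pt
  right_zero : h 0 = N.pt
  sat_iff : ∀ φ : HLFormula P I, φ.free ⊆ Set.Iio l → (Sat M g M.pt φ ↔ Sat N h N.pt φ)

theorem HLEquiv.hlMatching_one (H : HLEquiv M N) :
    HLMatching M N 1 (fun _ => M.pt) (fun _ => N.pt) where
  pos := one_pos
  left_zero := rfl
  right_zero := rfl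
  sat_iff φ hφ := by
    have hs : (down 0 φ).IsSentence :=
      Set.sdiff_eq_empty.2 fun x hx => Nat.lt_one_iff.1 (hφ hx)
    have hdown := H _ hs
    rwa [holds_iff M _ hs fun _ => M.pt, holds_iff N _ hs fun _ => N.pt, Sat, Sat,
      Function.update_eq_self, Function.update_eq_self] at hdown

namespace HLMatching

variable {l : ℕ} {g : ℕ → M.State} {h : ℕ → N.State}

theorem sat_iff_at (H : HLMatching M N l g h) {k : ℕ} (hk : k < l) {φ : HLFormula P I}
    (hφ : φ.free ⊆ Set.Iio l) : Sat M g (g k) φ ↔ Sat N h (h k) φ :=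
  H.sat_iff (atVar k φ) (Set.insert_subset hk hφ)

theorem eq_iff (H : HLMatching M N l g h) {j k : ℕ} (hj : j < l) (hk : k < l) :
    g j = g k ↔ h j = h k :=
  H.sat_iff_at hk (φ := wvar j) (Set.singleton_subset_iff.2 hj)

theorem val_iff (H : HLMatching M N l g h) {k : ℕ} (hk : k < l) (p : P) :
    M.val p (g k) ↔ N.val p (h k) :=
  H.sat_iff_at hk (φ := prop p) (Set.empty_subset _)

theorem rel_iff (H : HLMatching M N l g h) {j k : ℕ} (hj : j < l) (hk : k < l) (i : I) :
    M.rel i (g j) (g k) ↔ N.rel i (h j) (h k) := by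
  simpa [Sat] using H.sat_iff_at hj (φ := dia i (wvar k)) (Set.singleton_subset_iff.2 hk)

theorem exists_rel_sat_update_iff (H : HLMatching M N l g h) {k : ℕ} (hk : k < l) (i : I)
    {φ : HLFormula P I} (hφ : φ.free ⊆ Set.Iio (l + 1)) :
    (∃ m, M.rel i (g k) m ∧ Sat M (Function.update g l m) M.pt φ) ↔
      ∃ n, N.rel i (h k) n ∧ Sat N (Function.update h l n) N.pt φ := by
  have hfree : (dia i (down l (atVar 0 φ))).free ⊆ Set.Iio l := by
    rintro x ⟨rfl | hx, hxl⟩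
    exacts [H.pos, lt_of_le_of_ne (Nat.lt_succ_iff.1 (hφ hx)) hxl]
  simpa only [Sat, Function.update_of_ne H.pos.ne, H.left_zero, H.right_zero]
    using H.sat_iff_at hk hfree

theorem exists_separating_of_not_update (H : HLMatching M N l g h) {m : M.State} {n : N.State}
    (hmn : ¬ HLMatching M N (l + 1) (Function.update g l m) (Function.update h l n)) :
    ∃ φ : HLFormula P I, φ.free ⊆ Set.Iio (l + 1) ∧ Sat M (Function.update g l m) M.pt φ ∧
      ¬ Sat N (Function.update h l n) N.pt φ := by
  contrapose! hmn
  refine ⟨l.succ_pos, ?_, ?_, fun φ hφ => ⟨hmn φ hφ, fun hsat => ?_⟩⟩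
  · rw [Function.update_of_ne H.pos.ne, H.left_zero]
  · rw [Function.update_of_ne H.pos.ne, H.right_zero]
  · by_contra hnot
    exact hmn (not φ) hφ hnot hsat

theorem exists_update (H : HLMatching M N l g h) (hN : N.ImageFinite) {k : ℕ} (hk : k < l)
    {m : M.State} (hm : M.Step (g k) m) :
    ∃ n, HLMatching M N (l + 1) (Function.update g l m) (Function.update h l n) := by
  by_contra! hcon
  obtain ⟨i, hi⟩ := hm
  obtain ⟨φ, hφ, hsat, hnot⟩ := exists_separating_formula (n := fun _ => N.pt) (hN (h k))
    fun n _ => H.exists_separating_of_not_update (hcon n)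
  obtain ⟨n, hn, hsat'⟩ := (H.exists_rel_sat_update_iff hk i hφ).1 ⟨m, hi, hsat⟩
  exact hnot n ⟨i, hn⟩ hsat'

theorem exists_extension_of_step (H : HLMatching M N l g h) (hN : N.ImageFinite)
    {m n : M.State} (hm : m ∈ g '' Set.Iio l) (hmn : M.Step m n) :
    ∃ l' g' h', HLMatching M N l' g' h' ∧ insert n (g '' Set.Iio l) ⊆ g' '' Set.Iio l' := by
  obtain ⟨k, hk, rfl⟩ := hm
  obtain ⟨b, hb⟩ := H.exists_update hN hk hmn
  refine ⟨l + 1, _, _, hb, Set.insert_subset ⟨l, l.lt_succ_self, Function.update_self ..⟩ ?_⟩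
  rintro _ ⟨j, hj, rfl⟩
  exact ⟨j, Nat.lt_succ_of_lt hj, Function.update_of_ne (ne_of_lt hj) ..⟩

theorem exists_extension_of_reflTransGen (H : HLMatching M N l g h) (hN : N.ImageFinite)
    {m : M.State} (hm : Relation.ReflTransGen M.Step M.pt m) :
    ∃ l' g' h', HLMatching M N l' g' h' ∧ insert m (g '' Set.Iio l) ⊆ g' '' Set.Iio l' := by
  induction hm with
  | refl => exact ⟨l, g, h, H, Set.insert_subset ⟨0, H.pos, H.left_zero⟩ subset_rfl⟩
  | tail _ hstep ih =>
    obtain ⟨l', g', h', H', hsub⟩ := ih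
    obtain ⟨l'', g'', h'', H'', hsub'⟩ :=
      H'.exists_extension_of_step hN (hsub (Set.mem_insert _ _)) hstep
    exact ⟨l'', g'', h'', H'', (Set.insert_subset_insert
      ((Set.subset_insert _ _).trans hsub)).trans hsub'⟩

theorem nonempty_injHom_restrict (H : HLMatching M N l g h) {S : Set M.State} (hpt : M.pt ∈ S)
    (hS : S ⊆ g '' Set.Iio l) : Nonempty (InjHom (M.restrict S hpt) N) := by
  choose k hk hgk using fun m : (M.restrict S hpt).State => hS m.2
  refine ⟨⟨fun m => h (k m), ?_, fun p m hp => ?_, fun i m n hr => ?_⟩, fun m n hmn => ?_⟩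
  · rw [← H.right_zero, ← H.eq_iff (hk _) H.pos, hgk, H.left_zero]
    rfl
  · rwa [← H.val_iff (hk m), hgk]
  · rwa [← H.rel_iff (hk m) (hk n), hgk, hgk]
  · refine Subtype.ext ?_
    rw [← hgk m, ← hgk n]
    exact (H.eq_iff (hk m) (hk n)).2 hmn

end HLMatching

theorem HLEquiv.exists_hlMatching_covering (H : HLEquiv M N) (hM : M.PointGenerated)
    (hN : N.ImageFinite) {S : Set M.State} (hS : S.Finite) :
    ∃ l g h, HLMatching M N l g h ∧ S ⊆ g '' Set.Iio l := by
  induction S, hS using Set.Finite.induction_on with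
  | empty => exact ⟨1, _, _, H.hlMatching_one, Set.empty_subset _⟩
  | @insert m S _ _ ih =>
    obtain ⟨l, g, h, hmatch, hsub⟩ := ih
    obtain ⟨l', g', h', hmatch', hsub'⟩ := hmatch.exists_extension_of_reflTransGen hN (hM m)
    exact ⟨l', g', h', hmatch', (Set.insert_subset_insert hsub).trans hsub'⟩

theorem HLEquiv.nonempty_injHom_ballModel (H : HLEquiv M N) (hM : M.PointGenerated)
    (hMfin : M.ImageFinite) (hNfin : N.ImageFinite) (d : ℕ) :
    Nonempty (InjHom (M.ballModel d) N) := by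
  obtain ⟨l, g, h, hmatch, hsub⟩ := H.exists_hlMatching_covering hM hNfin (hMfin.finite_ball d)
  exact hmatch.nonempty_injHom_restrict (pt_mem_ball d) hsub

theorem HLEquiv.isomorphic (H : HLEquiv M N) (hM : M.PointGenerated) (hN : N.PointGenerated)
    (hMfin : M.ImageFinite) (hNfin : N.ImageFinite) : Isomorphic M N :=
  isomorphic_of_ballModel_injHom hM hN hMfin hNfin
    (H.nonempty_injHom_ballModel hM hMfin hNfin) (H.symm.nonempty_injHom_ballModel hN hNfin hMfin)

theorem hlEquiv_gsub_iff : HLEquiv M.gsub N.gsub ↔ HLEquiv M N :=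
  ⟨fun H => (hlEquiv_gsub M).symm.trans (H.trans (hlEquiv_gsub N)),
    fun H => (hlEquiv_gsub M).trans (H.trans (hlEquiv_gsub N).symm)⟩

end HybridLogic

theorem mainTheorem2_general {P : Type uP} {I : Type uI}
    (M : LTS.{uP, uI, u} P I) (N : LTS.{uP, uI, v} P I)
    (hM : M.gsub.ImageFinite) (hN : N.gsub.ImageFinite) :
    (∀ T ∈ LTS.PG.{uP, uI, w} P I, Finite (LTS.Hom T M) ∧ Finite (LTS.Hom T N)) ∧
    List.TFAE [
      LTS.leftProfile ℕ (LTS.PG.{uP, uI, w} P I) M = LTS.leftProfile ℕ (LTS.PG.{uP, uI, w} P I) N,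
      LTS.Isomorphic M.gsub N.gsub,
      HLEquiv M N] := by
  refine ⟨fun T hT => ?_, ?_⟩
  · have := hT.1
    have := hT.2.finite_hom hM
    have := hT.2.finite_hom hN
    exact ⟨.of_equiv _ (LTS.homEquivHomGsub hT.2).symm, .of_equiv _ (LTS.homEquivHomGsub hT.2).symm⟩
  have hcount : LTS.leftProfile ℕ (LTS.PG P I) M = LTS.leftProfile ℕ (LTS.PG P I) N ↔
      ∀ T ∈ LTS.PG.{uP, uI, w} P I,
        Nat.card (LTS.Hom T M.gsub) = Nat.card (LTS.Hom T N.gsub) := by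
    rw [LTS.leftProfile_nat_eq_iff]
    refine forall₂_congr fun T hT => ?_
    rw [Nat.card_congr (LTS.homEquivHomGsub (M := M) hT.2),
      Nat.card_congr (LTS.homEquivHomGsub (M := N) hT.2)]
  rw [hcount, ← hlEquiv_gsub_iff]
  tfae_have 1 → 2 := LTS.isomorphic_of_card_hom_eq LTS.pointGenerated_gsub
    LTS.pointGenerated_gsub hM hN
  tfae_have 2 → 1 := fun h T _ => h.card_hom_eq T
  tfae_have 2 → 3 := LTS.Isomorphic.hlEquiv
  tfae_have 3 → 2 := fun H => H.isomorphic LTS.pointGenerated_gsub LTS.pointGenerated_gsub hM hN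
  tfae_finish

theorem mainTheorem2 {P : Type uP} {I : Type uI} [Finite P] [Finite I]
    (M : LTS.{uP, uI, u} P I) (N : LTS.{uP, uI, v} P I)
    (hM : M.ImageFinite) (hN : N.ImageFinite) :
    (∀ T ∈ LTS.PG.{uP, uI, w} P I, Finite (LTS.Hom T M) ∧ Finite (LTS.Hom T N)) ∧
    List.TFAE [
      LTS.leftProfile ℕ (LTS.PG.{uP, uI, w} P I) M = LTS.leftProfile ℕ (LTS.PG.{uP, uI, w} P I) N,
      LTS.Isomorphic M.gsub N.gsub,
      HLEquiv M N] :=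
  mainTheorem2_general M N hM.gsub hN.gsub
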